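/- Let $\mathbb S$ be a nonempty compact Polish space and $\mathbb O=\mathbb R^p$. Let $(X_t,Y_t)_{t\ge 0}$ be a time-homogeneous $\mathbb S\times\mathbb O$-valued Feller–Markov process with càdlàg paths, realized as the canonical process on $\Omega=D([0,\infty);\mathbb S)\times D([0,\infty);\mathbb O)$ under a measurable family of laws $(\mathbf P_{(x,y)})$, where $\mathbf P_{(x,y)}$ has initial condition $(X_0,Y_0)=(x,y)$. Assume that the signal $X$ is Markov in its own right and that $Y$ has conditionally independent increments given $X$, in the sense that for every bounded random variable $\xi$ measurable with respect to $\sigma\{X_s,\,Y_s-Y_0 : s\ge 0\}$, the expectation $\mathbf E_{(x,y)}(\xi)$ does not depend on $y$. For a probability measure $\mu$ on $\mathbb S$ put $\mathbf P^\mu=\int \mathbf P_{(x,0)}\,\mu(dx)$, and write $\mu\backsim\nu$ if $\mathbf P^\mu$ and $\mathbf P^\nu$ coincide on $\sigma\{Y_s:s\ge 0\}$. Define the space of nonobservable measures and the space of observable functions by $$\mathcal N=\{\alpha\mu_1-\alpha\mu_2 : \alpha\in\mathbb R,\ \mu_1,\mu_2\in\mathcal P(\mathbb S),\ \mu_1\backsim\mu_2\},$$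 $$\mathcal O=\{f\in C(\mathbb S) : \textstyle\int f\,d\mu_1=\int f\,d\mu_2 \text{ whenever } \mu_1\backsim\mu_2\}.$$ Let $D$ be any dense subset of $[0,\infty)$, and let $\mathcal O^0$ be the linear span of the functions $$(x,y)\mapsto \mathbf E_{(x,y)}\bigl(f_1(Y_{t_1}-Y_0)\cdots f_n(Y_{t_n}-Y_0)\bigr),$$ for all $n<\infty$, $t_i\in D$ and bounded continuous $f_i:\mathbb O\to\mathbb R$. Then: 1. every element of $\mathcal O^0$ depends on $x$ only and is a (bounded) continuous function of $x\in\mathbb S$; 2. regarded as a space of functions on $\mathbb S$, $\mathcal O^0\subset\mathcal O$, and $\mathcal O^0$ is dense in $\mathcal O$ in the uniform norm; in particular, for every $f\in\mathcal O$ there is a sequence $f_n\in\mathcal O^0$ with $\|f-f_n\|_\infty\to 0$; 3. the annihilator of $\mathcal O^0$ in the space of finite signed Borel measures on $\mathbb S$, i.e. $\{\nu : \int g\,d\nu=0 \text{ for all } g\in\mathcal O^0\}$, equals $\mathcal N$. -/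

import Mathlib

open MeasureTheory ProbabilityTheory Filter Topology
open scoped NNReal BoundedContinuousFunction ZeroAtInfty

noncomputable section

namespace FilterModel

/-- A path `x : [0,∞) → S` is càdlàg: right-continuous with left limits. -/
def IsCadlag {S : Type*} [TopologicalSpace S] (x : ℝ≥0 → S) : Prop :=
  ∀ t, ContinuousWithinAt x (Set.Ici t) t ∧ ∃ l, Tendsto x (𝓝[<] t) (𝓝 l)

/-- The space `D([0,∞); S)` of càdlàg paths. -/
def CadlagPath (S : Type*) [TopologicalSpace S] : Type _ := {x : ℝ≥0 → S // IsCadlag x}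

/-- The σ-algebra on `D([0,∞); S)` generated by the coordinate maps. For a Polish space `S` it is
the Borel σ-algebra of the Skorokhod topology. -/
instance (S : Type*) [TopologicalSpace S] [MeasurableSpace S] : MeasurableSpace (CadlagPath S) :=
  inferInstanceAs (MeasurableSpace {x : ℝ≥0 → S // IsCadlag x})

/-- The observation state space `ℝ^p`. -/
abbrev Obs (p : ℕ) : Type := EuclideanSpace ℝ (Fin p)

/-- The canonical space `Ω = D([0,∞); S) × D([0,∞); ℝ^p)`. -/
abbrev PathSpace (S : Type*) [TopologicalSpace S] (p : ℕ) : Type _ :=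
  CadlagPath S × CadlagPath (Obs p)

section Canonical

variable {S : Type*} [TopologicalSpace S] {p : ℕ}

/-- The canonical signal process. -/
def X (t : ℝ≥0) (ω : PathSpace S p) : S := ω.1.1 t

/-- The canonical observation process. -/
def Y (t : ℝ≥0) (ω : PathSpace S p) : Obs p := ω.2.1 t

/-- The canonical signal-observation process. -/
def Z (t : ℝ≥0) (ω : PathSpace S p) : S × Obs p := (X t ω, Y t ω)

variable (S p) [MeasurableSpace S]

/-- `ℱ_t = σ{(X_s, Y_s) : s ≤ t}`. -/
def sigmaZ (t : ℝ≥0) : MeasurableSpace (PathSpace S p) :=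
  ⨆ s : ℝ≥0, ⨆ _ : s ≤ t, MeasurableSpace.comap (Z s) inferInstance

/-- `ℱ^X = σ{X_s : s ≥ 0}`. -/
def sigmaX : MeasurableSpace (PathSpace S p) :=
  ⨆ s : ℝ≥0, MeasurableSpace.comap (X s) inferInstance

/-- `ℱ^Y = σ{Y_s : s ≥ 0}`. -/
def sigmaY (S : Type*) [TopologicalSpace S] (p : ℕ) : MeasurableSpace (PathSpace S p) :=
  ⨆ s : ℝ≥0, MeasurableSpace.comap (Y s) inferInstance

/-- `𝒢^Y = σ{Y_s - Y_0 : s ≥ 0}`. -/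
def sigmaIncr (S : Type*) [TopologicalSpace S] (p : ℕ) : MeasurableSpace (PathSpace S p) :=
  ⨆ s : ℝ≥0, MeasurableSpace.comap (fun ω => Y s ω - Y 0 ω) inferInstance

end Canonical

/-- A (conservative) Feller transition semigroup `(P_t)` on a locally compact space `E`:
a Markov transition semigroup which maps `C₀(E)` to itself and satisfies `P_t f → f` pointwise
as `t → 0` for `f ∈ C₀(E)`. -/
structure IsFellerSemigroup {E : Type*} [TopologicalSpace E] [MeasurableSpace E]
    (P : ℝ≥0 → Kernel E E) : Prop where
  markov : ∀ t, IsMarkovKernel (P t)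
  zero : P 0 = Kernel.id
  chapman_kolmogorov : ∀ s t, P (s + t) = P t ∘ₖ P s
  map_zeroAtInfty : ∀ (t : ℝ≥0) (f : C₀(E, ℝ)), ∃ g : C₀(E, ℝ), ∀ z, g z = ∫ z', f z' ∂(P t z)
  tendsto_zero : ∀ (f : C₀(E, ℝ)) (z : E),
    Tendsto (fun t => ∫ z', f z' ∂(P t z)) (𝓝 0) (𝓝 (f z))

/-- The signal-observation model: a time-homogeneous `S × ℝ^p`-valued Feller-Markov process
with càdlàg paths, given by its transition semigroup `trans` and by the family of its laws
`law (x, y) = 𝐏_{(x,y)}` on the canonical path space, such that the signal is Markov in its own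
right and the observations have conditionally independent increments. -/
structure Model (S : Type*) [TopologicalSpace S] [MeasurableSpace S] (p : ℕ) where
  /-- the transition probabilities `P_t(x, y, A)` -/
  trans : ℝ≥0 → Kernel (S × Obs p) (S × Obs p)
  feller : IsFellerSemigroup trans
  /-- the laws `𝐏_{(x,y)}`, measurable in `(x, y)` -/
  law : Kernel (S × Obs p) (PathSpace S p)
  isMarkovKernel_law : IsMarkovKernel law
  /-- under `𝐏_{(x,y)}` the initial law is `δ_{(x,y)}` -/
  initial : ∀ z, (law z).map (Z 0) = Measure.dirac z
  /-- under `𝐏_{(x,y)}` the process is Markov with transition probabilities `P_t` -/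
  markov : ∀ (z : S × Obs p) (s t : ℝ≥0) (A : Set (S × Obs p)), MeasurableSet A →
    (law z)[Set.indicator (Z (s + t) ⁻¹' A) (fun _ => (1 : ℝ)) | sigmaZ S p s]
      =ᵐ[law z] fun ω => (trans t (Z s ω)).real A
  /-- for bounded `ℱ^X ∨ 𝒢^Y`-measurable `ξ`, the expectation `𝐄_{(x,y)}(ξ)` does not
  depend on `y` -/
  condIndepIncrements : ∀ ξ : PathSpace S p → ℝ,
    Measurable[sigmaX S p ⊔ sigmaIncr S p] ξ → (∃ C, ∀ ω, |ξ ω| ≤ C) →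
      ∀ x y y', ∫ ω, ξ ω ∂(law (x, y)) = ∫ ω, ξ ω ∂(law (x, y'))

namespace Model

variable {S : Type*} [TopologicalSpace S] [MeasurableSpace S] {p : ℕ} (M : Model S p)

/-- `𝐏^μ = 𝐏_{μ × δ_0}`, where `𝐏_ρ(A) = ∫ 𝐏_{(x,y)}(A) ρ(dx, dy)`. -/
def lawOf (μ : ProbabilityMeasure S) : Measure (PathSpace S p) :=
  ((μ : Measure S).prod (Measure.dirac (0 : Obs p))).bind M.law

/-- `μ ∽ ν`: the laws `𝐏^μ` and `𝐏^ν` coincide on `ℱ^Y`. -/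
def Equivalent (μ ν : ProbabilityMeasure S) : Prop :=
  ∀ A : Set (PathSpace S p), MeasurableSet[sigmaY S p] A → M.lawOf μ A = M.lawOf ν A

/-- The space `𝒩` of nonobservable measures. -/
def nonobservable : Set (SignedMeasure S) :=
  {ν | ∃ (α : ℝ) (μ₁ μ₂ : ProbabilityMeasure S), M.Equivalent μ₁ μ₂ ∧
    ν = α • (μ₁ : Measure S).toSignedMeasure - α • (μ₂ : Measure S).toSignedMeasure}

/-- The space `𝒪` of observable functions. -/
def observable : Set C(S, ℝ) :=
  {f | ∀ μ₁ μ₂ : ProbabilityMeasure S, M.Equivalent μ₁ μ₂ →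
    ∫ x, f x ∂(μ₁ : Measure S) = ∫ x, f x ∂(μ₂ : Measure S)}

/-- The linear span of the functions
`(x, y) ↦ 𝐄_{(x,y)}(f₁(Y_{t₁} - Y_0) ⋯ f_n(Y_{t_n} - Y_0))` on `S × ℝ^p`, with `t_i ∈ D` and
`f_i` bounded and continuous. -/
def cylinderSpan (D : Set ℝ≥0) : Submodule ℝ (S × Obs p → ℝ) :=
  Submodule.span ℝ {F | ∃ (n : ℕ) (t : Fin n → ℝ≥0) (f : Fin n → (Obs p →ᵇ ℝ)),
    (∀ i, t i ∈ D) ∧ F = fun z => ∫ ω, ∏ i, f i (Y (t i) ω - Y 0 ω) ∂(M.law z)}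

/-- The same span `𝒪⁰`, as a space of continuous functions on `S`: a function `g` on `S` is
identified with the function `(x, y) ↦ g x`. -/
def cylinderFunctions (D : Set ℝ≥0) : Submodule ℝ C(S, ℝ) where
  carrier := {g | (fun z : S × Obs p => g z.1) ∈ M.cylinderSpan D}
  add_mem' ha hb := (M.cylinderSpan D).add_mem ha hb
  zero_mem' := (M.cylinderSpan D).zero_mem
  smul_mem' c _ ha := (M.cylinderSpan D).smul_mem c ha

end Model

/-- The annihilator of a space of continuous functions on a compact space `S`, inside the space
of finite signed measures on `S`. -/
def annihilator {S : Type*} [TopologicalSpace S] [MeasurableSpace S]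
    (V : Submodule ℝ C(S, ℝ)) : Set (SignedMeasure S) :=
  {ν | ∀ g ∈ V, ∫ᵛ x, g x ∂<•ν = 0}

end FilterModel

end

/-! The key fact is that two probability measures are equivalent exactly when they integrate every
function of `𝒪⁰` alike. If `g ∈ 𝒪⁰`, then `∫ g dμ` is the `𝐏^μ`-expectation of a functional of the
observation increments, so it depends only on the law of `Y`. Conversely, these integrals give the
mixed moments of the increments at times in `D`; right-continuity extends them to all times, they
determine the finite-dimensional laws, and `Y₀ = 0` almost surely under `𝐏^μ`
(`equivalent_of_forall_integral_eq`).

The rest is duality. Since `1 ∈ 𝒪⁰`, finite measures that agree on `𝒪⁰` have equal mass and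
normalize to equivalent probabilities. Applied to the Jordan parts of a signed measure, this
identifies the annihilator with `𝒩`. Applied to the Riesz representation of a separating functional,
it gives density in `𝒪`.

Elements of `𝒪⁰` do not depend on `y`, by conditional independence of increments. Their continuity
comes from the Feller property, which covers only functions vanishing at infinity; a cutoff in `y`,
made uniform in `x` by Dini's theorem, removes this restriction (`continuous_integral_prod_Y`). -/

/-! ### Riesz representation of functionals on `C(S)` -/

namespace ContinuousMap

/-- A continuous linear functional on `C(S)`, `S` compact, is a difference of positive ones. -/
theorem exists_positive_sub_eq {S : Type*} [TopologicalSpace S] [CompactSpace S] [Nonempty S]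
    (φ : C(S, ℝ) →L[ℝ] ℝ) :
    ∃ Φ Ψ : C(S, ℝ) →ₗ[ℝ] ℝ, (∀ f, 0 ≤ f → 0 ≤ Φ f) ∧ (∀ f, 0 ≤ f → 0 ≤ Ψ f) ∧
      ∀ f, φ f = Φ f - Ψ f := by
  obtain ⟨x₀⟩ := ‹Nonempty S›
  -- `V` consists of the pairs whose sum is constant. For `u, v ≥ 0` in `V`, pointwise `|u - v| ≤ u
  -- + v`, hence `|φ (u - v)| ≤ ‖φ‖ (u + v)` and `L ≥ 0`. `V` contains the pairs of constants, so M.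
  -- Riesz extension gives a positive `G` on all pairs. Its restrictions to the two factors are `Φ`
  -- and `Ψ`, and their difference is read off from `(f, -f) ∈ V`.
  let V : Submodule ℝ (C(S, ℝ) × C(S, ℝ)) :=
    { carrier := {w | ∀ x, w.1 x + w.2 x = w.1 x₀ + w.2 x₀}
      add_mem' := fun {a b} ha hb x => by
        have h₁ := ha x
        have h₂ := hb x
        simp only [Prod.fst_add, Prod.snd_add, ContinuousMap.add_apply]
        linarith
      zero_mem' := fun x => by simp
      smul_mem' := fun c a ha x => by
        have h := ha x
        simp only [Prod.smul_fst, Prod.smul_snd, ContinuousMap.smul_apply, smul_eq_mul,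
          ← mul_add, h] }
  let L : C(S, ℝ) × C(S, ℝ) →ₗ[ℝ] ℝ :=
    { toFun := fun w => ‖φ‖ * ((w.1 x₀ + w.2 x₀) / 2) + φ (w.1 - w.2) / 2
      map_add' := fun a b => by
        simp only [Prod.fst_add, Prod.snd_add, ContinuousMap.add_apply, map_sub, map_add]
        ring
      map_smul' := fun c a => by
        simp only [Prod.smul_fst, Prod.smul_snd, ContinuousMap.smul_apply, smul_eq_mul, map_sub,
          map_smul, RingHom.id_apply]
        ring }
  obtain ⟨G, hG, hpos⟩ := riesz_extension (PointedCone.positive ℝ (C(S, ℝ) × C(S, ℝ)))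
    ⟨V, L.comp V.subtype⟩ (by
      rintro ⟨⟨u, v⟩, hw⟩ h
      rw [PointedCone.mem_positive] at h
      have hu : ∀ x, 0 ≤ u x := fun x => h.1 x
      have hv : ∀ x, 0 ≤ v x := fun x => h.2 x
      have hw' : ∀ x, u x + v x = u x₀ + v x₀ := hw
      have hn : ‖u - v‖ ≤ u x₀ + v x₀ := by
        rw [ContinuousMap.norm_le _ (add_nonneg (hu _) (hv _))]
        intro x
        rw [← hw' x, Real.norm_eq_abs, abs_le]
        have := hu x
        have := hv x
        simp only [ContinuousMap.sub_apply]
        constructor <;> linarith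
      have h₁ : |φ (u - v)| ≤ ‖φ‖ * (u x₀ + v x₀) :=
        (φ.le_opNorm _).trans (mul_le_mul_of_nonneg_left hn (norm_nonneg _))
      have h₂ := (abs_le.1 h₁).1
      change 0 ≤ ‖φ‖ * ((u x₀ + v x₀) / 2) + φ (u - v) / 2
      linarith) (by
      rintro ⟨u, v⟩
      refine ⟨⟨(const S (‖u‖ + ‖v‖), const S (‖u‖ + ‖v‖)), fun x => rfl⟩, ?_⟩
      rw [PointedCone.mem_positive]
      constructor <;> intro x
      · have := (abs_le.1 (u.norm_coe_le_norm x)).1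
        have := norm_nonneg v
        change 0 ≤ ‖u‖ + ‖v‖ + u x
        linarith
      · have := (abs_le.1 (v.norm_coe_le_norm x)).1
        have := norm_nonneg u
        change 0 ≤ ‖u‖ + ‖v‖ + v x
        linarith)
  refine ⟨G.comp (LinearMap.inl ℝ _ _), G.comp (LinearMap.inr ℝ _ _), fun f hf => hpos _ ?_,
    fun f hf => hpos _ ?_, fun f => ?_⟩
  · exact (PointedCone.mem_positive _ _).2 ⟨hf, le_rfl⟩
  · exact (PointedCone.mem_positive _ _).2 ⟨le_rfl, hf⟩
  · have h : (f, -f) ∈ V := fun x => by simp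
    have h₁ := hG ⟨(f, -f), h⟩
    have h₂ : (f, -f) = LinearMap.inl ℝ C(S, ℝ) C(S, ℝ) f - LinearMap.inr ℝ C(S, ℝ) C(S, ℝ) f := by
      simp
    have h₃ : G (f, -f) = φ f := by
      refine h₁.trans ?_
      change ‖φ‖ * ((f x₀ + (-f) x₀) / 2) + φ (f - -f) / 2 = φ f
      simp
    rw [← h₃, h₂, map_sub]
    rfl

/-- A positive linear functional on `C(S)`, `S` compact, is integration against a finite measure. -/
theorem exists_measure_of_nonneg {S : Type*} [TopologicalSpace S] [CompactSpace S] [T2Space S]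
    [MeasurableSpace S] [BorelSpace S] (Φ : C(S, ℝ) →ₗ[ℝ] ℝ) (hΦ : ∀ f, 0 ≤ f → 0 ≤ Φ f) :
    ∃ μ : Measure S, IsFiniteMeasure μ ∧ ∀ f : C(S, ℝ), Φ f = ∫ x, f x ∂μ := by
  let Λ : CompactlySupportedContinuousMap S ℝ →ₚ[ℝ] ℝ := PositiveLinearMap.mk₀
    { toFun := fun f => Φ (f : C(S, ℝ))
      map_add' := fun f g => map_add Φ (f : C(S, ℝ)) g
      map_smul' := fun c f => map_smul Φ c (f : C(S, ℝ)) } (fun f hf => hΦ _ hf)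
  refine ⟨RealRMK.rieszMeasure Λ, inferInstance, fun f => ?_⟩
  exact (RealRMK.integral_rieszMeasure Λ
    (CompactlySupportedContinuousMap.continuousMapEquiv f)).symm

/-- The Riesz representation theorem for continuous linear functionals on `C(S)`, `S` compact. -/
theorem exists_measure_sub_eq {S : Type*} [TopologicalSpace S] [CompactSpace S] [T2Space S]
    [Nonempty S] [MeasurableSpace S] [BorelSpace S] (φ : C(S, ℝ) →L[ℝ] ℝ) :
    ∃ μ ν : Measure S, IsFiniteMeasure μ ∧ IsFiniteMeasure ν ∧
      ∀ f : C(S, ℝ), φ f = ∫ x, f x ∂μ - ∫ x, f x ∂ν := by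
  obtain ⟨Φ, Ψ, hΦ, hΨ, h⟩ := exists_positive_sub_eq φ
  obtain ⟨μ, hμ, hμ'⟩ := exists_measure_of_nonneg Φ hΦ
  obtain ⟨ν, hν, hν'⟩ := exists_measure_of_nonneg Ψ hΨ
  exact ⟨μ, ν, hμ, hν, fun f => by rw [h, hμ', hν']⟩

end ContinuousMap

/-! ### Disintegration and the Markov property -/

namespace MeasureTheory.Measure

/-- A criterion for a Markov kernel to be a conditional distribution of `V` given `W`. -/
theorem map_prodMk_eq_compProd {Ω β E : Type*} [MeasurableSpace Ω] [MeasurableSpace β]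
    [MeasurableSpace E] (P : Measure Ω) [IsProbabilityMeasure P] {W : Ω → β} (hW : Measurable W)
    {V : Ω → E} (hV : Measurable V) (κ : Kernel β E) [IsMarkovKernel κ]
    (h : ∀ B A, MeasurableSet B → MeasurableSet A →
      P.real (W ⁻¹' B ∩ V ⁻¹' A) = ∫ ω in W ⁻¹' B, (κ (W ω)).real A ∂P) :
    P.map (fun ω => (W ω, V ω)) = (P.map W) ⊗ₘ κ := by
  have := isProbabilityMeasure_map (μ := P) (hW.prodMk hV).aemeasurable
  refine Measure.ext_prod fun {B A} hB hA => ?_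
  rw [map_apply (hW.prodMk hV) (hB.prod hA), compProd_apply_prod hB hA,
    setLIntegral_map hB (κ.measurable_coe hA) hW]
  have h₁ := h B A hB hA
  rw [measureReal_def] at h₁
  have h₂ : ∫ ω in W ⁻¹' B, (κ (W ω)).real A ∂P
      = (∫⁻ ω in W ⁻¹' B, κ (W ω) A ∂P).toReal :=
    integral_toReal ((κ.measurable_coe hA).comp hW).aemeasurable
      (Eventually.of_forall fun ω => measure_lt_top _ _)
  rw [h₂, ENNReal.toReal_eq_toReal_iff' (measure_ne_top _ _)] at h₁
  · exact h₁
  · refine ne_top_of_le_ne_top (measure_ne_top P (W ⁻¹' B)) ?_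
    calc ∫⁻ ω in W ⁻¹' B, κ (W ω) A ∂P ≤ ∫⁻ ω in W ⁻¹' B, 1 ∂P :=
          lintegral_mono fun ω => prob_le_one
      _ = P (W ⁻¹' B) := by simp

end MeasureTheory.Measure

namespace FilterModel

section Canonical

variable {S : Type*} [TopologicalSpace S] {p : ℕ}

theorem measurable_sigmaY (t : ℝ≥0) :
    Measurable[sigmaY S p] (Y t : PathSpace S p → Obs p) :=
  Measurable.of_comap_le (le_iSup (fun u : ℝ≥0 =>
    MeasurableSpace.comap (Y u : PathSpace S p → Obs p) inferInstance) t)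

theorem measurable_sigmaIncr (t : ℝ≥0) :
    Measurable[sigmaIncr S p] (fun ω : PathSpace S p => Y t ω - Y 0 ω) :=
  Measurable.of_comap_le (le_iSup (fun u : ℝ≥0 =>
    MeasurableSpace.comap (fun ω : PathSpace S p => Y u ω - Y 0 ω) inferInstance) t)

theorem sigmaIncr_le_sigmaY : sigmaIncr S p ≤ sigmaY S p :=
  iSup_le fun t => Measurable.comap_le (Measurable.sub (m := sigmaY S p)
    (measurable_sigmaY t) (measurable_sigmaY 0))

variable [MeasurableSpace S]

theorem measurable_X (t : ℝ≥0) : Measurable (X t : PathSpace S p → S) :=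
  (measurable_pi_apply t).comp (measurable_subtype_coe.comp measurable_fst)

theorem measurable_Y (t : ℝ≥0) : Measurable (Y t : PathSpace S p → Obs p) :=
  (measurable_pi_apply t).comp (measurable_subtype_coe.comp measurable_snd)

theorem measurable_Z (t : ℝ≥0) : Measurable (Z t : PathSpace S p → S × Obs p) :=
  (measurable_X t).prodMk (measurable_Y t)

theorem sigmaZ_le (t : ℝ≥0) : sigmaZ S p t ≤ (inferInstance : MeasurableSpace (PathSpace S p)) :=
  iSup₂_le fun s _ => (measurable_Z s).comap_le

theorem measurable_sigmaZ {s t : ℝ≥0} (h : s ≤ t) :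
    Measurable[sigmaZ S p t] (Z s : PathSpace S p → S × Obs p) :=
  Measurable.of_comap_le (le_iSup₂_of_le (f := fun (u : ℝ≥0) (_ : u ≤ t) =>
    MeasurableSpace.comap (Z u : PathSpace S p → S × Obs p) inferInstance) s h le_rfl)

theorem sigmaZ_mono {s t : ℝ≥0} (h : s ≤ t) : sigmaZ S p s ≤ sigmaZ S p t :=
  iSup₂_le fun _ hu => (measurable_sigmaZ (hu.trans h)).comap_le

theorem sigmaY_le : sigmaY S p ≤ (inferInstance : MeasurableSpace (PathSpace S p)) :=
  iSup_le fun t => (measurable_Y t).comap_le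

end Canonical

namespace Model

variable {S : Type*} [TopologicalSpace S] [MeasurableSpace S] {p : ℕ} (M : Model S p)

instance : IsMarkovKernel M.law := M.isMarkovKernel_law

instance (t : ℝ≥0) : IsMarkovKernel (M.trans t) := M.feller.markov t

/-- The Markov property, for expectations of bounded functions of the past and of the state at a
later time. -/
theorem integral_mul_comp_Z_add (z : S × Obs p) (s t : ℝ≥0) {ξ : PathSpace S p → ℝ}
    (hξ : Measurable[sigmaZ S p s] ξ) {C : ℝ} (hC : ∀ ω, |ξ ω| ≤ C) {h : S × Obs p → ℝ}
    (hh : Measurable h) {K : ℝ} (hK : ∀ z, |h z| ≤ K) :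
    ∫ ω, ξ ω * h (Z (s + t) ω) ∂(M.law z) =
      ∫ ω, ξ ω * ∫ z', h z' ∂(M.trans t (Z s ω)) ∂(M.law z) := by
  -- Recording `ξ` together with `Z s` lets one disintegration of the joint law handle the whole
  -- integrand; the kernel `κ` ignores the `ξ`-coordinate, which is the Markov property.
  let W : PathSpace S p → ℝ × (S × Obs p) := fun ω => (ξ ω, Z s ω)
  have hW' : Measurable[sigmaZ S p s] W :=
    Measurable.prodMk (m := sigmaZ S p s) hξ (measurable_sigmaZ le_rfl)
  have hξ₀ : Measurable ξ := hξ.mono (sigmaZ_le s) le_rfl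
  have hW : Measurable W := hW'.mono (sigmaZ_le s) le_rfl
  have hV : Measurable (Z (s + t) : PathSpace S p → S × Obs p) := measurable_Z _
  let κ : Kernel (ℝ × (S × Obs p)) (S × Obs p) := (M.trans t).comap Prod.snd measurable_snd
  have key : (M.law z).map (fun ω => (W ω, Z (s + t) ω)) = ((M.law z).map W) ⊗ₘ κ := by
    refine Measure.map_prodMk_eq_compProd _ hW hV κ fun B A hB hA => ?_
    have hBs : MeasurableSet[sigmaZ S p s] (W ⁻¹' B) := hW' hB
    have h₁ := setIntegral_condExp (μ := M.law z) (sigmaZ_le s)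
      (f := Set.indicator (Z (s + t) ⁻¹' A) fun _ => (1 : ℝ))
      ((integrable_const _).indicator (hV hA)) hBs
    rw [setIntegral_congr_ae (g := fun ω => (M.trans t (Z s ω)).real A) (sigmaZ_le s _ hBs)
      ((M.markov z s t A hA).mono fun ω h _ => h), setIntegral_indicator (hV hA)] at h₁
    have h₂ : (M.law z).real (W ⁻¹' B ∩ Z (s + t) ⁻¹' A) =
        ∫ ω in W ⁻¹' B, (M.trans t (Z s ω)).real A ∂(M.law z) := by simpa using h₁.symm
    exact h₂
  have hm : Measurable fun q : (ℝ × (S × Obs p)) × (S × Obs p) => q.1.1 * h q.2 := by fun_prop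
  have hint : Integrable (fun q : (ℝ × (S × Obs p)) × (S × Obs p) => q.1.1 * h q.2)
      (((M.law z).map W) ⊗ₘ κ) := by
    rw [← key, integrable_map_measure hm.aestronglyMeasurable (hW.prodMk hV).aemeasurable]
    refine Integrable.of_bound (hm.comp (hW.prodMk hV)).aestronglyMeasurable (C * K)
      (Eventually.of_forall fun ω => ?_)
    simp only [Function.comp_apply, norm_mul, Real.norm_eq_abs]
    exact mul_le_mul (hC ω) (hK _) (abs_nonneg _) ((abs_nonneg _).trans (hC ω))
  calc ∫ ω, ξ ω * h (Z (s + t) ω) ∂(M.law z)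
      = ∫ q, q.1.1 * h q.2 ∂((M.law z).map (fun ω => (W ω, Z (s + t) ω))) :=
        (integral_map (hW.prodMk hV).aemeasurable hm.aestronglyMeasurable).symm
    _ = ∫ w, ∫ z', w.1 * h z' ∂(κ w) ∂((M.law z).map W) := by
        rw [key, Measure.integral_compProd hint]
    _ = ∫ w, w.1 * ∫ z', h z' ∂(M.trans t w.2) ∂((M.law z).map W) := by
        simp_rw [integral_const_mul]
        rfl
    _ = _ := by
        rw [integral_map hW.aemeasurable]
        refine Measurable.aestronglyMeasurable (measurable_fst.mul ?_)
        exact (hh.stronglyMeasurable.integral_kernel (κ := M.trans t)).measurable.comp measurable_snd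

theorem ae_Z_zero (z : S × Obs p) [MeasurableSingletonClass S] : ∀ᵐ ω ∂(M.law z), Z 0 ω = z := by
  have h : ∀ᵐ w ∂((M.law z).map (Z 0)), w = z := by
    rw [M.initial, ae_dirac_iff (p := fun w => w = z) (measurableSet_singleton z)]
  exact ae_of_ae_map (measurable_Z 0).aemeasurable h

end Model

end FilterModel

/-! ### Feller continuity of cylinder expectations -/

namespace ZeroAtInftyContinuousMap

/-- The product of a function vanishing at infinity and a bounded continuous function. -/
def mulBounded {E : Type*} [TopologicalSpace E] (h : C₀(E, ℝ)) (G : E →ᵇ ℝ) : C₀(E, ℝ) where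
  toFun z := h z * G z
  continuous_toFun := h.continuous.mul G.continuous
  zero_at_infty' := h.zero_at_infty'.zero_mul_isBoundedUnder_le
    (isBoundedUnder_of ⟨‖G‖, fun z => G.norm_coe_le_norm z⟩)

end ZeroAtInftyContinuousMap

namespace FilterModel

theorem abs_prod_le {ι Ω : Type*} [Fintype ι] (f : ι → (Ω → ℝ)) {B : ι → ℝ}
    (h : ∀ i ω, |f i ω| ≤ B i) (ω : Ω) : |∏ i, f i ω| ≤ ∏ i, B i := by
  rw [Finset.abs_prod]
  exact Finset.prod_le_prod (fun i _ => abs_nonneg _) fun i _ => h i ω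

section Cutoff

/-- A continuous cutoff function on `ℝ^p`, equal to `1` on the ball of radius `R` and to `0`
outside the ball of radius `R + 1`. -/
noncomputable def cutoff (p R : ℕ) (y : Obs p) : ℝ := max 0 (min 1 (R + 1 - ‖y‖))

variable {p : ℕ}

theorem continuous_cutoff (R : ℕ) : Continuous (cutoff p R) := by
  unfold cutoff
  fun_prop

theorem cutoff_nonneg (R : ℕ) (y : Obs p) : 0 ≤ cutoff p R y := le_max_left _ _

theorem cutoff_le_one (R : ℕ) (y : Obs p) : cutoff p R y ≤ 1 :=
  max_le zero_le_one (min_le_left _ _)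

theorem monotone_cutoff (y : Obs p) : Monotone fun R => cutoff p R y := fun R R' h => by
  have : (R : ℝ) ≤ R' := by exact_mod_cast h
  exact max_le_max le_rfl (min_le_min le_rfl (by linarith))

theorem tendsto_cutoff (y : Obs p) : Tendsto (fun R => cutoff p R y) atTop (𝓝 1) := by
  obtain ⟨N, hN⟩ := exists_nat_ge ‖y‖
  refine tendsto_const_nhds.congr' ?_
  filter_upwards [eventually_ge_atTop N] with R hR
  have : (N : ℝ) ≤ R := by exact_mod_cast hR
  unfold cutoff
  rw [min_eq_left (by linarith), max_eq_right zero_le_one]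

theorem cutoff_eq_zero {R : ℕ} {y : Obs p} (h : (R : ℝ) + 1 ≤ ‖y‖) : cutoff p R y = 0 :=
  max_eq_left ((min_le_right _ _).trans (by linarith))

/-- A bounded continuous function of the observation, cut off, as a function on `S × ℝ^p`
vanishing at infinity. -/
noncomputable def cutoffMul (S : Type*) [TopologicalSpace S] [CompactSpace S] (R : ℕ) (f : Obs p →ᵇ ℝ) :
    C₀(S × Obs p, ℝ) where
  toFun z := f z.2 * cutoff p R z.2
  continuous_toFun :=
    (f.continuous.comp continuous_snd).mul ((continuous_cutoff R).comp continuous_snd)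
  zero_at_infty' := by
    refine tendsto_const_nhds.congr' ?_
    have hK : IsCompact (Set.univ ×ˢ Metric.closedBall (0 : Obs p) (R + 1) : Set (S × Obs p)) :=
      isCompact_univ.prod (isCompact_closedBall _ _)
    filter_upwards [hK.compl_mem_cocompact] with z hz
    have : (R : ℝ) + 1 ≤ ‖z.2‖ := by
      by_contra! h
      exact hz ⟨Set.mem_univ _, by simpa using h.le⟩
    simp [cutoff_eq_zero this]

end Cutoff

namespace Model

variable {S : Type*} [TopologicalSpace S] [MeasurableSpace S] {p : ℕ} (M : Model S p)

theorem measurable_prod_Y {n : ℕ} (t : Fin n → ℝ≥0) (f : Fin n → (Obs p →ᵇ ℝ)) :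
    Measurable fun ω : PathSpace S p => ∏ i, f i (Y (t i) ω) :=
  Finset.measurable_fun_prod _ fun i _ => (f i).continuous.measurable.comp (measurable_Y _)

section Feller

variable [BorelSpace S]

/-- By the Feller property, expectations of products of functions vanishing at infinity at
successive times are bounded continuous functions of the present state. -/
theorem exists_integral_mul_prod_eq (n : ℕ) : ∀ (s : ℝ≥0) (t : Fin n → ℝ≥0)
    (h : Fin n → C₀(S × Obs p, ℝ)), Monotone t → (∀ i, s ≤ t i) →
    ∃ G : S × Obs p →ᵇ ℝ, ∀ (z : S × Obs p) (ξ : PathSpace S p → ℝ),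
      Measurable[sigmaZ S p s] ξ → (∃ C, ∀ ω, |ξ ω| ≤ C) →
      ∫ ω, ξ ω * ∏ i, h i (Z (t i) ω) ∂(M.law z) = ∫ ω, ξ ω * G (Z s ω) ∂(M.law z) := by
  induction n with
  | zero => exact fun s t h _ _ => ⟨1, fun z ξ _ _ => by simp⟩
  | succ n ih =>
    intro s t h ht hs
    -- Factors after time `t 0` collapse to `G (Z (t 0))`. `G` need not vanish at infinity (it is
    -- `1` for the empty product), but `h 0 * G` does, so the semigroup carries it back to time `s`.
    obtain ⟨G, hG⟩ := ih (t 0) (fun i => t i.succ) (fun i => h i.succ)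
      (fun i j hij => ht (Fin.succ_le_succ_iff.2 hij)) (fun i => ht (Fin.zero_le _))
    obtain ⟨g, hg⟩ := M.feller.map_zeroAtInfty (t 0 - s) ((h 0).mulBounded G)
    refine ⟨g.toBCF, fun z ξ hξ ⟨C, hC⟩ => ?_⟩
    have hb : ∀ (k : C₀(S × Obs p, ℝ)) w, |k w| ≤ ‖k.toBCF‖ := fun k w =>
      k.toBCF.norm_coe_le_norm w
    have hst : s + (t 0 - s) = t 0 := add_tsub_cancel_of_le (hs 0)
    have h₁ := hG z (fun ω => ξ ω * h 0 (Z (t 0) ω))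
      (Measurable.mul (m := sigmaZ S p (t 0)) (hξ.mono (sigmaZ_mono (hs 0)) le_rfl)
        ((h 0).continuous.measurable.comp (measurable_sigmaZ le_rfl)))
      ⟨C * ‖(h 0).toBCF‖, fun ω => by
        rw [abs_mul]
        exact mul_le_mul (hC ω) (hb _ _) (abs_nonneg _) ((abs_nonneg _).trans (hC ω))⟩
    have h₂ := M.integral_mul_comp_Z_add z s (t 0 - s) hξ hC
      ((h 0).mulBounded G).continuous.measurable (hb _)
    rw [hst] at h₂
    calc _ = ∫ ω, ξ ω * h 0 (Z (t 0) ω) * ∏ i : Fin n, h i.succ (Z (t i.succ) ω) ∂(M.law z) := by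
          simp_rw [Fin.prod_univ_succ, mul_assoc]
      _ = ∫ ω, ξ ω * ((h 0).mulBounded G) (Z (t 0) ω) ∂(M.law z) := by
          rw [h₁]
          simp_rw [mul_assoc]
          rfl
      _ = _ := h₂.trans (integral_congr_ae (Eventually.of_forall fun ω =>
          congrArg (ξ ω * ·) (hg (Z s ω)).symm))

/-- After sorting the times, take `s = 0` and `ξ = 1` above: since `Z 0 = z` almost surely, the
expectation is `G z`. -/
theorem continuous_integral_prod_zeroAtInfty {n : ℕ} (t : Fin n → ℝ≥0)
    (h : Fin n → C₀(S × Obs p, ℝ)) [T1Space S] :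
    Continuous fun z => ∫ ω, ∏ i, h i (Z (t i) ω) ∂(M.law z) := by
  obtain ⟨G, hG⟩ := M.exists_integral_mul_prod_eq n 0 (t ∘ Tuple.sort t)
    (fun i => h (Tuple.sort t i)) (Tuple.monotone_sort t) (fun i => zero_le)
  convert G.continuous using 2 with z
  have h₁ := hG z (fun _ => 1) measurable_const ⟨1, by simp⟩
  simp only [one_mul, Function.comp_apply] at h₁
  have h₂ : ∀ ω : PathSpace S p, ∏ i, h (Tuple.sort t i) (Z (t (Tuple.sort t i)) ω) =
      ∏ i, h i (Z (t i) ω) := fun ω =>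
    Equiv.prod_comp (Tuple.sort t) fun i => h i (Z (t i) ω)
  simp_rw [h₂] at h₁
  rw [h₁, integral_congr_ae ((M.ae_Z_zero z).mono fun ω hω => congrArg G hω)]
  simp

variable [CompactSpace S] [T1Space S]

/-- Expectations of products of bounded continuous functions of the observations are continuous
in the initial state of the signal. -/
theorem continuous_integral_prod_Y {n : ℕ} (t : Fin n → ℝ≥0) (f : Fin n → (Obs p →ᵇ ℝ)) :
    Continuous fun x => ∫ ω, ∏ i, f i (Y (t i) ω) ∂(M.law (x, 0)) := by
  have hcont : ∀ (R : ℕ) (f : Fin n → (Obs p →ᵇ ℝ)), Continuous fun x => ∫ ω, ∏ i,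
      (f i (Y (t i) ω) * cutoff p R (Y (t i) ω)) ∂(M.law (x, 0)) := fun R f =>
    (M.continuous_integral_prod_zeroAtInfty t fun i => cutoffMul S R (f i)).comp
      (continuous_id.prodMk continuous_const)
  have hmeas : ∀ R : ℕ, Measurable fun ω : PathSpace S p => ∏ i, cutoff p R (Y (t i) ω) :=
    fun R => Finset.measurable_fun_prod _ fun i _ =>
      (continuous_cutoff R).measurable.comp (measurable_Y _)
  have hnn : ∀ (R : ℕ) (ω : PathSpace S p), 0 ≤ ∏ i, cutoff p R (Y (t i) ω) := fun R ω =>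
    Finset.prod_nonneg fun i _ => cutoff_nonneg _ _
  have hle : ∀ (R : ℕ) (ω : PathSpace S p), ∏ i, cutoff p R (Y (t i) ω) ≤ 1 := fun R ω =>
    Finset.prod_le_one (fun i _ => cutoff_nonneg _ _) fun i _ => cutoff_le_one _ _
  have hint : ∀ (R : ℕ) x, Integrable (fun ω => ∏ i, cutoff p R (Y (t i) ω)) (M.law (x, 0)) :=
    fun R x => Integrable.of_bound (hmeas R).aestronglyMeasurable 1
      (Eventually.of_forall fun ω => by
        rw [Real.norm_eq_abs, abs_of_nonneg (hnn R ω)]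
        exact hle R ω)
  -- Dini on the compact space `S`: these continuous functions of `x` increase with `R` to `1`. This
  -- is tightness of the observations uniformly in the initial signal.
  have hdini : TendstoUniformly
      (fun (R : ℕ) x => ∫ ω, ∏ i, cutoff p R (Y (t i) ω) ∂(M.law (x, 0))) (fun _ => 1) atTop := by
    refine Monotone.tendstoUniformly_of_forall_tendsto (fun R => ?_) (fun R R' hR x => ?_)
      continuous_const fun x => ?_
    · simpa using hcont R fun _ => 1
    · exact integral_mono (hint R x) (hint R' x) fun ω =>
        Finset.prod_le_prod (fun i _ => cutoff_nonneg _ _) fun i _ => monotone_cutoff _ hR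
    · have h₁ := tendsto_integral_of_dominated_convergence (μ := M.law (x, 0)) (fun _ => (1 : ℝ))
        (F := fun (R : ℕ) ω => ∏ i, cutoff p R (Y (t i) ω)) (f := fun _ => 1)
        (fun R => (hmeas R).aestronglyMeasurable) (integrable_const _)
        (fun R => Eventually.of_forall fun ω => by
          rw [Real.norm_eq_abs, abs_of_nonneg (hnn R ω)]
          exact hle R ω)
        (Eventually.of_forall fun ω => by
          simpa using tendsto_finsetProd Finset.univ fun i _ =>
            tendsto_cutoff (Y (t i) ω))
      simpa using h₁
  set C : ℝ := ∏ i, ‖f i‖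
  have hC : 0 ≤ C := Finset.prod_nonneg fun i _ => norm_nonneg _
  have hf : ∀ ω : PathSpace S p, |∏ i, f i (Y (t i) ω)| ≤ C :=
    abs_prod_le (fun i ω => f i (Y (t i) ω)) fun i ω => (f i).norm_coe_le_norm _
  have hfint : ∀ x, Integrable (fun ω => ∏ i, f i (Y (t i) ω)) (M.law (x, 0)) := fun x =>
    Integrable.of_bound (measurable_prod_Y t f).aestronglyMeasurable C (Eventually.of_forall hf)
  refine TendstoUniformly.continuous (p := atTop) (F := fun (R : ℕ) x => ∫ ω, ∏ i,
      (f i (Y (t i) ω) * cutoff p R (Y (t i) ω)) ∂(M.law (x, 0))) ?_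
    (Frequently.of_forall fun R => hcont R f)
  rw [Metric.tendstoUniformly_iff] at hdini ⊢
  intro ε hε
  -- The cutoff error is at most `C` times `1` minus the cutoff expectation; dividing by `C + 1`
  -- allows for `C = 0`.
  filter_upwards [hdini (ε / (C + 1)) (by positivity)] with R hR x
  have h₁ := hR x
  rw [Real.dist_eq, abs_lt] at h₁
  simp_rw [Finset.prod_mul_distrib]
  rw [dist_eq_norm, ← integral_sub (hfint x)
    ((hfint x).mul_bdd (c := 1) (hmeas R).aestronglyMeasurable (Eventually.of_forall fun ω => by
        rw [Real.norm_eq_abs, abs_of_nonneg (hnn R ω)]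
        exact hle R ω))]
  calc _ ≤ ∫ ω, C * (1 - ∏ i, cutoff p R (Y (t i) ω)) ∂(M.law (x, 0)) := by
        refine norm_integral_le_of_norm_le
          (((integrable_const _).sub (hint R x)).const_mul C) (Eventually.of_forall fun ω => ?_)
        rw [← mul_one_sub, norm_mul, Real.norm_eq_abs, Real.norm_eq_abs,
          abs_of_nonneg (sub_nonneg.2 (hle R ω))]
        exact mul_le_mul_of_nonneg_right (hf ω) (sub_nonneg.2 (hle R ω))
    _ = C * (1 - ∫ ω, ∏ i, cutoff p R (Y (t i) ω) ∂(M.law (x, 0))) := by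
        rw [integral_const_mul, integral_sub (integrable_const _) (hint R x)]
        simp
    _ ≤ C * (ε / (C + 1)) := mul_le_mul_of_nonneg_left h₁.2.le hC
    _ < ε := by
        rw [mul_div_assoc', div_lt_iff₀ (by positivity)]
        linarith

end Feller

end Model

end FilterModel

/-! ### Determining measures by products; approximation of times -/

namespace MeasureTheory.Measure

/-- Finite measures on a finite product are determined by the integrals of products of bounded
continuous functions of the coordinates. -/
theorem ext_of_integral_prod_boundedContinuousFunction {ι E : Type*} [Fintype ι]
    [MeasurableSpace E] [TopologicalSpace E] [BorelSpace E] [HasOuterApproxClosed E]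
    {μ ν : Measure (ι → E)} [IsFiniteMeasure μ] [IsFiniteMeasure ν]
    (h : ∀ f : ι → (E →ᵇ ℝ), ∫ x, ∏ i, f i (x i) ∂μ = ∫ x, ∏ i, f i (x i) ∂ν) : μ = ν := by
  -- A dummy one-point factor puts the measures in the form of the criterion with an additional test
  -- function `g`, which only contributes a constant.
  let e : (ι → E) → (ι → E) × Unit := fun x => (x, ())
  have he : Measurable e := measurable_id.prodMk measurable_const
  have hμ : ∀ (ρ : Measure (ι → E)), (ρ.map e).map Prod.fst = ρ := fun ρ => by
    rw [map_map measurable_fst he]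
    exact map_id
  rw [← hμ μ, ← hμ ν]
  congr 1
  refine _root_.Measure.ext_of_integral_prod_mul_boundedContinuousFunction fun f g => ?_
  have hm : Measurable fun q : (ι → E) × Unit => (∏ i, f i (q.1 i)) * g q.2 :=
    (Finset.measurable_fun_prod _ fun i _ => (f i).continuous.measurable.comp
      ((measurable_pi_apply i).comp measurable_fst)).mul
      (g.continuous.measurable.comp measurable_snd)
  rw [integral_map he.aemeasurable hm.aestronglyMeasurable,
    integral_map he.aemeasurable hm.aestronglyMeasurable]
  simp only [e, integral_mul_const, h]

end MeasureTheory.Measure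

/-- Points of `[0, ∞)` are limits from the right of sequences in a dense set. -/
theorem Dense.exists_seq_tendsto_of_ge {D : Set ℝ≥0} (hD : Dense D) (t : ℝ≥0) :
    ∃ u : ℕ → ℝ≥0, (∀ n, u n ∈ D) ∧ Tendsto u atTop (𝓝[≥] t) := by
  obtain ⟨u, -, hu, hut⟩ := hD.exists_seq_strictAnti_tendsto t
  exact ⟨u, fun n => (hu n).2, tendsto_nhdsWithin_iff.2
    ⟨hut, Eventually.of_forall fun n => Set.Ioi_subset_Ici_self (hu n).1⟩⟩

/-! ### Cylinder functions and the law of the observations -/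

namespace FilterModel

section Increments

variable {S : Type*} [TopologicalSpace S] {p : ℕ}

/-- A product of bounded continuous functions of the increments of the observations. -/
noncomputable def incrProd (S : Type*) [TopologicalSpace S] {p : ℕ} {ι : Type*} [Fintype ι]
    (t : ι → ℝ≥0) (f : ι → (Obs p →ᵇ ℝ)) (ω : PathSpace S p) : ℝ :=
  ∏ i, f i (Y (t i) ω - Y 0 ω)

theorem measurable_incrProd {ι : Type*} [Fintype ι] (t : ι → ℝ≥0) (f : ι → (Obs p →ᵇ ℝ)) :
    Measurable[sigmaIncr S p] (incrProd S t f) :=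
  Finset.measurable_fun_prod (m := sigmaIncr S p) _ fun i _ =>
    (f i).continuous.measurable.comp (measurable_sigmaIncr (t i))

theorem abs_incrProd_le {ι : Type*} [Fintype ι] (t : ι → ℝ≥0) (f : ι → (Obs p →ᵇ ℝ))
    (ω : PathSpace S p) : |incrProd S t f ω| ≤ ∏ i, ‖f i‖ :=
  abs_prod_le (fun i (ω : PathSpace S p) => f i (Y (t i) ω - Y 0 ω))
    (fun i _ => (f i).norm_coe_le_norm _) ω

end Increments

namespace Model

variable {S : Type*} [TopologicalSpace S] [MeasurableSpace S] {p : ℕ} (M : Model S p)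

instance (μ : ProbabilityMeasure S) : IsProbabilityMeasure (M.lawOf μ) :=
  inferInstanceAs (IsProbabilityMeasure
    (M.law ∘ₘ ((μ : Measure S).prod (Measure.dirac (0 : Obs p)))))

theorem integral_lawOf (μ : ProbabilityMeasure S) {ξ : PathSpace S p → ℝ} (hξ : Measurable ξ)
    {C : ℝ} (hC : ∀ ω, |ξ ω| ≤ C) :
    ∫ ω, ξ ω ∂(M.lawOf μ) = ∫ x, ∫ ω, ξ ω ∂(M.law (x, 0)) ∂(μ : Measure S) := by
  have hint : Integrable ξ (M.lawOf μ) :=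
    Integrable.of_bound hξ.aestronglyMeasurable C (Eventually.of_forall hC)
  have h : M.lawOf μ = (M.law ∘ₖ Kernel.const Unit
      ((μ : Measure S).prod (Measure.dirac (0 : Obs p)))) () :=
    Measure.comp_eq_comp_const_apply
  rw [h] at hint ⊢
  rw [Kernel.integral_comp hint, Kernel.const_apply, Measure.prod_dirac, integral_map]
  · exact (measurable_id.prodMk measurable_const).aemeasurable
  · exact (hξ.stronglyMeasurable.integral_kernel (κ := M.law)).aestronglyMeasurable

theorem ae_Y_zero [MeasurableSingletonClass S] (μ : ProbabilityMeasure S) :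
    ∀ᵐ ω ∂(M.lawOf μ), Y 0 ω = 0 := by
  have hm : MeasurableSet {ω : PathSpace S p | Y 0 ω = 0} :=
    measurable_Y 0 (measurableSet_singleton 0)
  have h : ∀ᵐ ω ∂(M.law ∘ₘ ((μ : Measure S).prod (Measure.dirac (0 : Obs p)))), Y 0 ω = 0 := by
    rw [Measure.ae_comp_iff hm, Measure.prod_dirac, ae_map_iff]
    · exact Eventually.of_forall fun x => (M.ae_Z_zero (x, 0)).mono fun ω hω =>
        congrArg Prod.snd hω
    · exact (measurable_id.prodMk measurable_const).aemeasurable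
    · have : Measurable fun z => M.law z {ω | Y 0 ω = 0}ᶜ := M.law.measurable_coe hm.compl
      exact this (measurableSet_singleton 0)
  exact h

theorem integral_eq_of_equivalent {μ ν : ProbabilityMeasure S} (h : M.Equivalent μ ν)
    {ξ : PathSpace S p → ℝ} (hξ : Measurable[sigmaY S p] ξ) :
    ∫ ω, ξ ω ∂(M.lawOf μ) = ∫ ω, ξ ω ∂(M.lawOf ν) := by
  have ht : (M.lawOf μ).trim sigmaY_le = (M.lawOf ν).trim sigmaY_le := by
    refine @Measure.ext _ (sigmaY S p) _ _ fun A hA => ?_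
    rw [trim_measurableSet_eq sigmaY_le hA, trim_measurableSet_eq sigmaY_le hA, h A hA]
  have hs : StronglyMeasurable[sigmaY S p] ξ := Measurable.stronglyMeasurable hξ
  rw [integral_trim sigmaY_le hs, integral_trim sigmaY_le hs, ht]

variable {M} {D : Set ℝ≥0}

theorem measurable_incr : Measurable fun (ω : PathSpace S p) (t : ℝ≥0) => Y t ω - Y 0 ω :=
  measurable_pi_lambda _ fun t => (measurable_Y t).sub (measurable_Y 0)

theorem sigmaIncr_le : sigmaIncr S p ≤ (inferInstance : MeasurableSpace (PathSpace S p)) :=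
  sigmaIncr_le_sigmaY.trans sigmaY_le

/-- Elements of the span are expectations of bounded functions of the increments of the
observations. -/
theorem exists_eq_integral_of_mem_cylinderSpan {F : S × Obs p → ℝ} (hF : F ∈ M.cylinderSpan D) :
    ∃ ξ : PathSpace S p → ℝ, Measurable[sigmaIncr S p] ξ ∧ (∃ C, ∀ ω, |ξ ω| ≤ C) ∧
      ∀ z, F z = ∫ ω, ξ ω ∂(M.law z) := by
  have hint : ∀ {ξ : PathSpace S p → ℝ} (_ : Measurable[sigmaIncr S p] ξ)
      (_ : ∃ C, ∀ ω, |ξ ω| ≤ C) z, Integrable ξ (M.law z) := fun hξ ⟨C, hC⟩ z =>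
    Integrable.of_bound (hξ.mono sigmaIncr_le le_rfl).aestronglyMeasurable C
      (Eventually.of_forall hC)
  induction hF using Submodule.span_induction with
  | mem F hF =>
    obtain ⟨n, t, f, -, rfl⟩ := hF
    exact ⟨incrProd S t f, measurable_incrProd t f, ⟨_, abs_incrProd_le t f⟩, fun z => rfl⟩
  | zero => exact ⟨fun _ => 0, measurable_const, ⟨0, by simp⟩, fun z => by simp⟩
  | add F G _ _ hF hG =>
    obtain ⟨ξ, hξ, ⟨C, hC⟩, hF⟩ := hF
    obtain ⟨η, hη, ⟨K, hK⟩, hG⟩ := hG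
    refine ⟨fun ω => ξ ω + η ω, Measurable.add (m := sigmaIncr S p) hξ hη,
      ⟨C + K, fun ω => (abs_add_le _ _).trans (add_le_add (hC ω) (hK ω))⟩, fun z => ?_⟩
    rw [integral_add (hint hξ ⟨C, hC⟩ z) (hint hη ⟨K, hK⟩ z), Pi.add_apply, hF, hG]
  | smul c F _ hF =>
    obtain ⟨ξ, hξ, ⟨C, hC⟩, hF⟩ := hF
    refine ⟨fun ω => c * ξ ω, Measurable.const_mul (m := sigmaIncr S p) hξ c,
      ⟨|c| * C, fun ω => ?_⟩, fun z => ?_⟩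
    · rw [abs_mul]
      exact mul_le_mul_of_nonneg_left (hC ω) (abs_nonneg c)
    · rw [integral_const_mul, Pi.smul_apply, hF, smul_eq_mul]

/-- One increment functional `ξ` represents `F` at every starting point, so conditional independence
of increments applies to it directly. -/
theorem eq_comp_fst_of_mem_cylinderSpan {F : S × Obs p → ℝ} (hF : F ∈ M.cylinderSpan D)
    (x : S) (y : Obs p) : F (x, y) = F (x, 0) := by
  obtain ⟨ξ, hξ, hC, h⟩ := exists_eq_integral_of_mem_cylinderSpan hF
  rw [h, h]
  exact M.condIndepIncrements ξ (hξ.mono le_sup_right le_rfl) hC x y 0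

/-- Integrals of the functions in `𝒪⁰` are expectations of functions of the observations. -/
theorem exists_integral_eq_of_mem_cylinderFunctions {g : C(S, ℝ)}
    (hg : g ∈ M.cylinderFunctions D) :
    ∃ ξ : PathSpace S p → ℝ, Measurable[sigmaY S p] ξ ∧
      ∀ μ : ProbabilityMeasure S, ∫ x, g x ∂(μ : Measure S) = ∫ ω, ξ ω ∂(M.lawOf μ) := by
  obtain ⟨ξ, hξ, ⟨C, hC⟩, h⟩ := exists_eq_integral_of_mem_cylinderSpan hg
  refine ⟨ξ, hξ.mono sigmaIncr_le_sigmaY le_rfl, fun μ => ?_⟩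
  rw [M.integral_lawOf μ (hξ.mono sigmaIncr_le le_rfl) hC]
  exact integral_congr_ae (Eventually.of_forall fun x => h (x, 0))

theorem cylinderFunctions_subset_observable :
    (M.cylinderFunctions D : Set C(S, ℝ)) ⊆ M.observable := fun g hg μ ν h => by
  obtain ⟨ξ, hξ, hμ⟩ := exists_integral_eq_of_mem_cylinderFunctions hg
  rw [hμ, hμ, M.integral_eq_of_equivalent h hξ]

variable [CompactSpace S] [T1Space S] [BorelSpace S]

theorem exists_continuousMap_of_mem_cylinderSpan {F : S × Obs p → ℝ}
    (hF : F ∈ M.cylinderSpan D) : ∃ g : C(S, ℝ), F = fun z => g z.1 := by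
  suffices h : Continuous fun x => F (x, 0) from
    ⟨⟨fun x => F (x, 0), h⟩, funext fun z => eq_comp_fst_of_mem_cylinderSpan hF z.1 z.2⟩
  induction hF using Submodule.span_induction with
  | mem F hF =>
    obtain ⟨n, t, f, -, rfl⟩ := hF
    convert M.continuous_integral_prod_Y t f using 2 with x
    -- Started from `(x, 0)`, the increments coincide almost surely with the observations.
    refine integral_congr_ae ((M.ae_Z_zero (x, 0)).mono fun ω hω => ?_)
    have h : Y 0 ω = 0 := congrArg Prod.snd hω
    simp [h]
  | zero => exact continuous_const
  | add F G _ _ hF hG => exact hF.add hG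
  | smul c F _ hF => exact hF.const_smul c

section Law

variable {μ ν : ProbabilityMeasure S}

theorem integral_incrProd_eq_of_mem (h : ∀ g ∈ M.cylinderFunctions D,
      ∫ x, g x ∂(μ : Measure S) = ∫ x, g x ∂(ν : Measure S))
    {n : ℕ} (t : Fin n → ℝ≥0) (ht : ∀ i, t i ∈ D) (f : Fin n → (Obs p →ᵇ ℝ)) :
    ∫ ω, incrProd S t f ω ∂(M.lawOf μ) = ∫ ω, incrProd S t f ω ∂(M.lawOf ν) := by
  have hF : (fun z => ∫ ω, incrProd S t f ω ∂(M.law z)) ∈ M.cylinderSpan D :=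
    Submodule.subset_span ⟨n, t, f, ht, rfl⟩
  obtain ⟨g, hg⟩ := exists_continuousMap_of_mem_cylinderSpan hF
  have hgD : g ∈ M.cylinderFunctions D := by
    change (fun z : S × Obs p => g z.1) ∈ M.cylinderSpan D
    rwa [← hg]
  have hm : Measurable (incrProd S t f) := (measurable_incrProd t f).mono sigmaIncr_le le_rfl
  have hg' : ∀ x, ∫ ω, incrProd S t f ω ∂(M.law (x, 0)) = g x := fun x =>
    congrFun hg (x, 0)
  rw [M.integral_lawOf μ hm (abs_incrProd_le t f), M.integral_lawOf ν hm (abs_incrProd_le t f)]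
  simp_rw [hg']
  exact h g hgD

/-- Each time is approached from the right within `D`; right-continuity of paths and dominated
convergence pass the identity to the limit. -/
theorem integral_incrProd_eq (hD : Dense D) (h : ∀ g ∈ M.cylinderFunctions D,
      ∫ x, g x ∂(μ : Measure S) = ∫ x, g x ∂(ν : Measure S))
    {n : ℕ} (t : Fin n → ℝ≥0) (f : Fin n → (Obs p →ᵇ ℝ)) :
    ∫ ω, incrProd S t f ω ∂(M.lawOf μ) = ∫ ω, incrProd S t f ω ∂(M.lawOf ν) := by
  choose u hu hut using fun i => hD.exists_seq_tendsto_of_ge (t i)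
  have hlim : ∀ ρ : ProbabilityMeasure S,
      Tendsto (fun k => ∫ ω, incrProd S (fun i => u i k) f ω ∂(M.lawOf ρ)) atTop
        (𝓝 (∫ ω, incrProd S t f ω ∂(M.lawOf ρ))) := fun ρ =>
    tendsto_integral_of_dominated_convergence (fun _ => ∏ i, ‖f i‖)
      (fun k => ((measurable_incrProd _ f).mono sigmaIncr_le le_rfl).aestronglyMeasurable)
      (integrable_const _)
      (fun k => Eventually.of_forall fun ω => abs_incrProd_le _ f ω)
      (Eventually.of_forall fun ω => tendsto_finsetProd Finset.univ fun i _ =>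
        ((f i).continuous.tendsto _).comp
          ((Tendsto.comp (ω.2.2 (t i)).1 (hut i)).sub tendsto_const_nhds))
  refine tendsto_nhds_unique (hlim μ) ?_
  simp_rw [integral_incrProd_eq_of_mem h _ (fun i => hu i _) f]
  exact hlim ν

/-- A law on the full product is fixed by its finite-dimensional marginals, and these by the product
moments. -/
theorem map_incr_eq (hD : Dense D) (h : ∀ g ∈ M.cylinderFunctions D,
      ∫ x, g x ∂(μ : Measure S) = ∫ x, g x ∂(ν : Measure S)) :
    (M.lawOf μ).map (fun ω (t : ℝ≥0) => Y t ω - Y 0 ω) =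
      (M.lawOf ν).map (fun ω (t : ℝ≥0) => Y t ω - Y 0 ω) := by
  have hmap : ∀ ρ : ProbabilityMeasure S,
      IsProbabilityMeasure ((M.lawOf ρ).map (fun ω (t : ℝ≥0) => Y t ω - Y 0 ω)) := fun ρ =>
    Measure.isProbabilityMeasure_map measurable_incr.aemeasurable
  have hr : ∀ I : Finset ℝ≥0, Measurable (I.restrict : (ℝ≥0 → Obs p) → (I → Obs p)) :=
    fun I => Finset.measurable_restrict I
  refine IsProjectiveLimit.unique (P := fun I => ((M.lawOf ν).map
    (fun ω (t : ℝ≥0) => Y t ω - Y 0 ω)).map I.restrict) (fun I => ?_) fun I => rfl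
  refine Measure.ext_of_integral_prod_boundedContinuousFunction fun f => ?_
  have hρ : ∀ ρ : ProbabilityMeasure S, ∫ x, ∏ i, f i (x i)
      ∂(((M.lawOf ρ).map (fun ω (t : ℝ≥0) => Y t ω - Y 0 ω)).map I.restrict) =
      ∫ ω, incrProd S (fun k => ((Fintype.equivFin I).symm k : ℝ≥0))
        (fun k => f ((Fintype.equivFin I).symm k)) ω ∂(M.lawOf ρ) := fun ρ => by
    have hm : Measurable fun x : I → Obs p => ∏ i, f i (x i) :=
      Finset.measurable_fun_prod _ fun i _ => (f i).continuous.measurable.comp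
        (measurable_pi_apply i)
    rw [Measure.map_map (hr I) measurable_incr,
      integral_map ((hr I).comp measurable_incr).aemeasurable hm.aestronglyMeasurable]
    exact integral_congr_ae (Eventually.of_forall fun ω =>
      (Equiv.prod_comp (Fintype.equivFin I).symm fun i : I => f i (Y i ω - Y 0 ω)).symm)
  rw [hρ μ, hρ ν, integral_incrProd_eq hD h]

/-- Since `Y 0 = 0` almost surely under `𝐏^ρ`, an event of the path of `Y` has the same probability
as that event for the increments. -/
theorem equivalent_of_forall_integral_eq (hD : Dense D) (h : ∀ g ∈ M.cylinderFunctions D,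
      ∫ x, g x ∂(μ : Measure S) = ∫ x, g x ∂(ν : Measure S)) : M.Equivalent μ ν := by
  intro A hA
  have hs : sigmaY S p =
      MeasurableSpace.comap (fun (ω : PathSpace S p) (t : ℝ≥0) => Y t ω) MeasurableSpace.pi := by
    simp_rw [sigmaY, MeasurableSpace.pi, MeasurableSpace.comap_iSup, MeasurableSpace.comap_comp]
    rfl
  rw [hs] at hA
  obtain ⟨B, hB, rfl⟩ := hA
  have hρ : ∀ ρ : ProbabilityMeasure S,
      M.lawOf ρ ((fun (ω : PathSpace S p) (t : ℝ≥0) => Y t ω) ⁻¹' B) =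
        (M.lawOf ρ).map (fun ω (t : ℝ≥0) => Y t ω - Y 0 ω) B := fun ρ => by
    rw [Measure.map_apply measurable_incr hB]
    refine measure_congr ((M.ae_Y_zero ρ).mono fun ω hω => ?_)
    simp only [eq_iff_iff]
    change (fun t => Y t ω) ∈ B ↔ (fun t => Y t ω - Y 0 ω) ∈ B
    simp [hω]
  rw [hρ, hρ, map_incr_eq hD h]

end Law

end Model

end FilterModel

/-! ### Duality: annihilator and density -/

namespace FilterModel

namespace Model

variable {S : Type*} [TopologicalSpace S] [MeasurableSpace S] {p : ℕ} {M : Model S p}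
  {D : Set ℝ≥0}

/-- The empty product (`n = 0`) works even for empty `D`; this is what forces equal masses below. -/
theorem one_mem_cylinderFunctions : (1 : C(S, ℝ)) ∈ M.cylinderFunctions D :=
  Submodule.subset_span ⟨0, Fin.elim0, Fin.elim0, fun i => i.elim0, by ext z; simp⟩

variable [CompactSpace S] [BorelSpace S]

theorem _root_.ContinuousMap.integrable_of_compactSpace (g : C(S, ℝ)) (μ : Measure S)
    [IsFiniteMeasure μ] : Integrable g μ :=
  Integrable.of_bound g.continuous.measurable.aestronglyMeasurable ‖g‖
    (Eventually.of_forall g.norm_coe_le_norm)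

theorem _root_.ContinuousMap.integral_toSignedMeasure_sub (g : C(S, ℝ)) (μ ν : Measure S)
    [IsFiniteMeasure μ] [IsFiniteMeasure ν] (α : ℝ) :
    ∫ᵛ x, g x ∂<•(α • μ.toSignedMeasure - α • ν.toSignedMeasure) =
      α * (∫ x, g x ∂μ - ∫ x, g x ∂ν) := by
  have h : ∀ ρ : Measure S, [IsFiniteMeasure ρ] → ρ.toSignedMeasure.Integrable g := fun ρ _ => by
    rw [VectorMeasure.Integrable, Measure.variation_toSignedMeasure]
    exact g.integrable_of_compactSpace ρ
  rw [VectorMeasure.integral_sub_vectorMeasure ((h μ).smul_vectorMeasure α)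
    ((h ν).smul_vectorMeasure α), VectorMeasure.integral_smul_vectorMeasure,
    VectorMeasure.integral_smul_vectorMeasure, VectorMeasure.integral_toSignedMeasure,
    VectorMeasure.integral_toSignedMeasure, smul_eq_mul, smul_eq_mul, mul_sub]

theorem nonobservable_subset_annihilator :
    M.nonobservable ⊆ annihilator (M.cylinderFunctions D) := by
  rintro _ ⟨α, μ₁, μ₂, h, rfl⟩ g hg
  rw [g.integral_toSignedMeasure_sub, cylinderFunctions_subset_observable hg μ₁ μ₂ h, sub_self,
    mul_zero]

variable [T1Space S] [Nonempty S]

/-- Finite measures which agree on `𝒪⁰` are the same multiple of equivalent probability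
measures. -/
theorem exists_equivalent_of_forall_integral_eq (hD : Dense D) (μ ν : Measure S)
    [IsFiniteMeasure μ] [IsFiniteMeasure ν]
    (h : ∀ g ∈ M.cylinderFunctions D, ∫ x, g x ∂μ = ∫ x, g x ∂ν) :
    ∃ (c : ℝ≥0) (μ₁ μ₂ : ProbabilityMeasure S), M.Equivalent μ₁ μ₂ ∧
      μ = c • (μ₁ : Measure S) ∧ ν = c • (μ₂ : Measure S) := by
  let μ' : FiniteMeasure S := ⟨μ, inferInstance⟩
  let ν' : FiniteMeasure S := ⟨ν, inferInstance⟩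
  have hμ : μ = μ'.mass • (μ'.normalize : Measure S) :=
    congrArg (fun ρ : FiniteMeasure S => (ρ : Measure S)) μ'.self_eq_mass_smul_normalize
  have hν : ν = ν'.mass • (ν'.normalize : Measure S) :=
    congrArg (fun ρ : FiniteMeasure S => (ρ : Measure S)) ν'.self_eq_mass_smul_normalize
  have hm : μ'.mass = ν'.mass := by
    have h₁ := h 1 one_mem_cylinderFunctions
    simp only [ContinuousMap.one_apply, integral_const, smul_eq_mul, mul_one] at h₁
    exact NNReal.coe_injective h₁
  rw [← hm] at hν
  -- At zero mass both measures vanish and any probability measure serves with `c = 0`; otherwise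
  -- the common mass cancels.
  rcases eq_or_ne μ'.mass 0 with h0 | h0
  · rw [h0, zero_smul] at hμ hν
    exact ⟨0, μ'.normalize, μ'.normalize, fun A _ => rfl, by rw [hμ, zero_smul],
      by rw [hν, zero_smul]⟩
  · refine ⟨μ'.mass, μ'.normalize, ν'.normalize,
      equivalent_of_forall_integral_eq hD fun g hg => ?_, hμ, hν⟩
    have h₁ := h g hg
    rw [hμ, hν, integral_smul_nnreal_measure, integral_smul_nnreal_measure] at h₁
    exact smul_right_injective _ h0 h₁

/-- The two Jordan parts of an annihilating measure agree on `𝒪⁰`, so they are a common multiple `c`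
of equivalent probabilities. -/
theorem annihilator_subset_nonobservable (hD : Dense D) :
    annihilator (M.cylinderFunctions D) ⊆ M.nonobservable := by
  intro ρ hρ
  have hJ := ρ.toSignedMeasure_toJordanDecomposition
  rw [JordanDecomposition.toSignedMeasure] at hJ
  obtain ⟨c, μ₁, μ₂, h, h₁, h₂⟩ := exists_equivalent_of_forall_integral_eq (M := M) hD
    ρ.toJordanDecomposition.posPart ρ.toJordanDecomposition.negPart fun g hg => by
      have h₁ := g.integral_toSignedMeasure_sub ρ.toJordanDecomposition.posPart
        ρ.toJordanDecomposition.negPart 1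
      rw [one_smul, one_smul, hJ, hρ g hg, one_mul] at h₁
      exact (sub_eq_zero.1 h₁.symm)
  refine ⟨c, μ₁, μ₂, h, ?_⟩
  rw [← hJ, Measure.toSignedMeasure_congr h₁, Measure.toSignedMeasure_congr h₂,
    Measure.toSignedMeasure_smul, Measure.toSignedMeasure_smul]
  rfl

/-- A functional separating `f` from the closure must vanish on `𝒪⁰`. By Riesz it is a multiple of a
difference of equivalent probabilities, so it kills every observable `f`, against `φ f < u < 0`. -/
theorem observable_subset_closure [T2Space S] (hD : Dense D) :
    M.observable ⊆ closure (M.cylinderFunctions D : Set C(S, ℝ)) := by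
  intro f hf
  by_contra hfc
  let V := (M.cylinderFunctions D).topologicalClosure
  have hconv : Convex ℝ (V : Set C(S, ℝ)) := V.convex
  obtain ⟨φ, u, hφf, hφ⟩ := geometric_hahn_banach_point_closed hconv
    (M.cylinderFunctions D).isClosed_topologicalClosure hfc
  have hu : u < 0 := by simpa using hφ 0 V.zero_mem
  have hφ0 : ∀ g ∈ M.cylinderFunctions D, φ g = 0 := fun g hg => by
    by_contra hne
    -- The multiple of `g` on which `φ` equals `u` would violate the strict bound `u < φ`.
    have h₁ := hφ ((u / φ g) • g) (V.smul_mem _ ((M.cylinderFunctions D).le_topologicalClosure hg))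
    rw [map_smul, smul_eq_mul, div_mul_cancel₀ _ hne] at h₁
    exact lt_irrefl _ h₁
  obtain ⟨μ, ν, _, _, h⟩ := ContinuousMap.exists_measure_sub_eq φ
  obtain ⟨c, μ₁, μ₂, he, rfl, rfl⟩ := exists_equivalent_of_forall_integral_eq hD μ ν
    fun g hg => sub_eq_zero.1 ((h g).symm.trans (hφ0 g hg))
  have : φ f = 0 := by
    rw [h, integral_smul_nnreal_measure, integral_smul_nnreal_measure, hf μ₁ μ₂ he, sub_self]
  linarith

end Model

end FilterModel

theorem mainTheorem7 {S : Type*} [TopologicalSpace S] [CompactSpace S] [PolishSpace S]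
    [Nonempty S] [MeasurableSpace S] [BorelSpace S] (p : ℕ) (M : FilterModel.Model S p)
    (D : Set ℝ≥0) (hD : Dense D) :
    -- every element of the span depends on `x` only, and is continuous in `x`
    (∀ F ∈ M.cylinderSpan D, ∃ g : C(S, ℝ), F = fun z => g z.1) ∧
    -- it is contained in the space of observable functions, and uniformly dense there
    (M.cylinderFunctions D : Set C(S, ℝ)) ⊆ M.observable ∧
    M.observable ⊆ closure (M.cylinderFunctions D : Set C(S, ℝ)) ∧
    (∀ f ∈ M.observable, ∃ u : ℕ → C(S, ℝ), (∀ n, u n ∈ M.cylinderFunctions D) ∧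
      Tendsto (fun n => ‖f - u n‖) atTop (𝓝 0)) ∧
    -- its annihilator is the space of nonobservable measures
    FilterModel.annihilator (M.cylinderFunctions D) = M.nonobservable := by
  refine ⟨fun F hF => FilterModel.Model.exists_continuousMap_of_mem_cylinderSpan hF,
    FilterModel.Model.cylinderFunctions_subset_observable,
    FilterModel.Model.observable_subset_closure hD, fun f hf => ?_,
    (FilterModel.Model.annihilator_subset_nonobservable hD).antisymm
      FilterModel.Model.nonobservable_subset_annihilator⟩
  obtain ⟨u, hu, hlim⟩ :=
    mem_closure_iff_seq_limit.1 (FilterModel.Model.observable_subset_closure hD hf)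
  refine ⟨u, hu, ?_⟩
  simp_rw [← dist_eq_norm, dist_comm f]
  exact tendsto_iff_dist_tendsto_zero.1 hlim
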